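/- **Conventions.** Let $\mathbb{N}_0=\{0,1,2,\dots\}$, and for $s\in\mathbb{N}_0$ put $[s]=\{0,1,\dots,s-1\}$; for $s\ge 1$, $n_{[s]}\in[s]$ is the remainder of $n$ modulo $s$. A $\beta$-set is a finite subset of $\mathbb{N}_0$. If $X=\{a_1>a_2>\dots>a_t\}$ is a $\beta$-set, $p(X)$ is the partition whose parts are the nonzero numbers among $a_i-(t-i)$. For $d\ge 1$, a $d$-symbol is a $d$-tuple $S=(X_0,\dots,X_{d-1})$ of $\beta$-sets, and $s_d$ is the bijection from $\beta$-sets to $d$-symbols given by $s_d(X)=(X_0^{(d)},\dots,X_{d-1}^{(d)})$ with $X_j^{(d)}=\{k\in\mathbb{N}_0 : j+kd\in X\}$. *Hooks.* A hook of $S$ is a quadruple $(a,b,i,j)$ with $a\ge b$ in $\mathbb{N}_0$, $i,j\in[d]$, $a\in X_i$, $b\notin X_j$, and $i>j$ if $a=b$. The set of hooks is $H(S)$. The multiset of hook lengths of $S$ is that of all $a-b$, $(a,b,i,j)\in H(S)$; $\mathcal{H}_{>0}(S)$ is the multiset of those that are nonzero. For real numbers $c_0,\dots,c_{d-1}$ and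 $k\ge 0$, and $\delta=(c_0,\dots,c_{d-1};k)$, the $\delta$-hook length of $(a,b,i,j)$ is $h^\delta(a,b,i,j)=k(a-b)+c_i-c_j$. *Core and balanced quotient.* For a $d$-symbol $S=(X_0,\dots,X_{d-1})$ put $C(S)=([\,|X_0|\,],\dots,[\,|X_{d-1}|\,])$, and $Q(S)=(Y_0,\dots,Y_{d-1})$, where $Y_i$ is the $\beta$-set with $p(Y_i)=p(X_i)$ and $|Y_i|=r$, $r$ being the maximal number of parts of the partitions $p(X_0),\dots,p(X_{d-1})$. *$\ell$-core and $\ell$-quotient.* For $\ell\ge 1$ and a $d$-symbol $S$, let $S_{*\ell}=s_{d\ell}(s_d^{-1}(S))$, a $d\ell$-symbol. Put $Q_\ell(S)=Q(S_{*\ell})$ (a $d\ell$-symbol) and $C_{(\ell)}(S)=s_d(s_{d\ell}^{-1}(C(S_{*\ell})))$ (a $d$-symbol). Let $\delta_{\ell,S}=(c_0,\dots,c_{d\ell-1};\ell)$ with $c_{sd+i}=s+x_{i,s}\,\ell$ for $s\in[\ell]$, $i\in[d]$, where $x_{i,s}$ is the number of elements of $X_i$ congruent to $s$ modulo $\ell$.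 *Twist.* For $e\in[d]$, let $\sigma=\sigma_{d,\ell,e}$ be the permutation of $\mathbb{N}_0$ with $\sigma(r\,d\ell+sd+t)=r\,d\ell+sd+(t+re)_{[d]}$ for $r\in\mathbb{N}_0$, $s\in[\ell]$, $t\in[d]$. For a $d$-symbol $S$ put $\sigma(S)=s_d(\sigma(s_d^{-1}(S)))$; this is a bijection on $d$-symbols. The $(\ell,e)$-core $C_{(\ell,e)}(S)$ is the $d$-symbol with $\sigma(C_{(\ell,e)}(S))=C_{(\ell)}(\sigma(S))$, and the balanced $(\ell,e)$-quotient is the $d\ell$-symbol $Q_{\ell,e}(S)=Q_\ell(\sigma(S))$. **Theorem 5.4.** Let $d,\ell\ge 1$ be integers, let $e\in[d]$, and let $S$ be a $d$-symbol. Let $C=C_{(\ell,e)}(S)$, $Q=Q_{\ell,e}(S)$ and $\delta=\delta_{\ell,\sigma(S)}$. Then there is the equality of multisets $$\mathcal{H}_{>0}(S)=\mathrm{abs}(\mathcal{H}^{\delta}_{>0}(Q))\cup\mathcal{H}_{>0}(C),$$ where $\mathrm{abs}(\mathcal{H}^{\delta}_{>0}(Q))$ is the multiset of all nonzero $|h^\delta(z)|$,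 $z\in H(Q)$, and $\cup$ is the union of multisets in which multiplicities are added. -/

import Mathlib

namespace DSymb

/-- A `d`-symbol: a `d`-tuple of beta-sets, a beta-set being a finite subset of `ℕ = {0, 1, …}`. -/
abbrev Symbol (d : ℕ) : Type := Fin d → Finset ℕ

/-! ### The bijection between beta-sets and symbols -/

/-- The `j`-th component `{k | j + k d ∈ X}` of the symbol attached to the beta-set `X`. -/
def component (d : ℕ) (X : Finset ℕ) (j : Fin d) : Finset ℕ :=
  (X.filter fun n => n % d = j).image fun n => n / d

theorem mem_component {d : ℕ} {X : Finset ℕ} {j : Fin d} {k : ℕ} :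
    k ∈ component d X j ↔ (j : ℕ) + k * d ∈ X := by
  have hd : 0 < d := lt_of_le_of_lt (Nat.zero_le _) j.2
  simp only [component, Finset.mem_image, Finset.mem_filter]
  constructor
  · rintro ⟨n, ⟨hn, hj⟩, rfl⟩
    rw [← hj, Nat.mod_add_div']
    exact hn
  · intro h
    refine ⟨_, ⟨h, ?_⟩, ?_⟩
    · rw [Nat.add_mul_mod_self_right, Nat.mod_eq_of_lt j.2]
    · rw [Nat.add_mul_div_right _ _ hd, Nat.div_eq_of_lt j.2, zero_add]

/-- The beta-set `{j + k d | j < d, k ∈ S j}` of a `d`-symbol `S`. -/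
def assemble (d : ℕ) (S : Symbol d) : Finset ℕ :=
  Finset.univ.biUnion fun j => (S j).image fun k => (j : ℕ) + k * d

/-- The bijection `s_d` from beta-sets to `d`-symbols. -/
def symbolEquiv (d : ℕ) [NeZero d] : Finset ℕ ≃ Symbol d where
  toFun X := fun j => component d X j
  invFun S := assemble d S
  left_inv X := by
    ext n
    simp only [assemble, Finset.mem_biUnion, Finset.mem_univ, true_and, Finset.mem_image,
      mem_component]
    constructor
    · rintro ⟨j, k, h, rfl⟩
      exact h
    · intro h
      refine ⟨⟨n % d, Nat.mod_lt _ (NeZero.pos d)⟩, n / d, ?_, ?_⟩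
      · simpa only [Nat.mod_add_div'] using h
      · exact Nat.mod_add_div' n d
  right_inv S := by
    funext j
    ext k
    rw [mem_component]
    simp only [assemble, Finset.mem_biUnion, Finset.mem_univ, true_and, Finset.mem_image]
    have hd : 0 < d := NeZero.pos d
    constructor
    · rintro ⟨i, m, h, hm⟩
      have h1 := congrArg (· % d) hm
      have h2 := congrArg (· / d) hm
      simp only [Nat.add_mul_mod_self_right, Nat.mod_eq_of_lt i.2, Nat.mod_eq_of_lt j.2,
        Nat.add_mul_div_right _ _ hd, Nat.div_eq_of_lt i.2, Nat.div_eq_of_lt j.2, zero_add]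
        at h1 h2
      have hij : i = j := Fin.ext h1
      subst hij
      subst h2
      exact h
    · intro h
      exact ⟨j, k, h, rfl⟩

/-! ### Partitions of beta-sets, balanced quotient and core -/

/-- For `X = {a_1 > … > a_t}`, the multiset of the numbers `a_i - (t - i)`; here `t - i` is the
number of elements of `X` that are smaller than `a_i`. -/
def shiftedParts (X : Finset ℕ) : Multiset ℕ :=
  X.val.map fun a => a - (X.filter fun x => x < a).card

/-- The partition `p(X)`, whose parts are the nonzero numbers among the `a_i - (t - i)`. -/
def partition (X : Finset ℕ) : Σ n : ℕ, n.Partition :=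
  ⟨(shiftedParts X).sum, Nat.Partition.ofMultiset (shiftedParts X)⟩

/-- The number of parts of a partition. -/
def numParts (κ : Σ n : ℕ, n.Partition) : ℕ := κ.2.parts.card

/-- The beta-set `{κ_1 + (r - 1), κ_2 + (r - 2), …, κ_r + 0}` for the partition
`κ = (κ_1 ≥ κ_2 ≥ …)`, where `κ` is extended by zeros. When `r` is at least the number of
parts of `κ`, it is the unique beta-set of cardinality `r` for `κ`. -/
def betaSet (κ : Σ n : ℕ, n.Partition) (r : ℕ) : Finset ℕ :=
  (Finset.range r).image fun i => (κ.2.parts.sort (· ≥ ·)).getD i 0 + (r - 1 - i)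

/-- The balanced `d`-symbol `t_d(κ_0, …, κ_{d-1})` of a `d`-tuple of partitions: each `κ_i` is
replaced by its beta-set of cardinality the maximal number of parts of the `κ_j`. -/
def balancedSymbol {d : ℕ} (κ : Fin d → Σ n : ℕ, n.Partition) : Symbol d :=
  fun i => betaSet (κ i) (Finset.univ.sup fun j => numParts (κ j))

/-- The balanced quotient `Q(S) = t_d(p(X_0), …, p(X_{d-1}))`. -/
def balancedQuotient {d : ℕ} (S : Symbol d) : Symbol d :=
  balancedSymbol fun i => partition (S i)

/-- The core `C(S) = ([x_0], …, [x_{d-1}])`, where `x_i = |X_i|` and `[x] = {0, …, x - 1}`. -/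
def core {d : ℕ} (S : Symbol d) : Symbol d := fun i => Finset.range (S i).card

/-! ### Hooks and generalized hook lengths -/

/-- `(a, b, i, j)` is a hook of `S`. -/
def IsHook {d : ℕ} (S : Symbol d) (z : ℕ × ℕ × Fin d × Fin d) : Prop :=
  z.2.1 ≤ z.1 ∧ z.1 ∈ S z.2.2.1 ∧ z.2.1 ∉ S z.2.2.2 ∧ (z.1 = z.2.1 → z.2.2.2 < z.2.2.1)

instance {d : ℕ} (S : Symbol d) : DecidablePred (IsHook S) := fun z => by
  unfold IsHook
  infer_instance

/-- The (finite) set of hooks of `S`. -/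
def hooks {d : ℕ} (S : Symbol d) : Finset (ℕ × ℕ × Fin d × Fin d) :=
  (Finset.range ((Finset.univ.sup fun i => (S i).sup id) + 1) ×ˢ
    Finset.range ((Finset.univ.sup fun i => (S i).sup id) + 1) ×ˢ
    Finset.univ ×ˢ Finset.univ).filter (IsHook S)

theorem mem_hooks {d : ℕ} (S : Symbol d) (z : ℕ × ℕ × Fin d × Fin d) :
    z ∈ hooks S ↔ IsHook S z := by
  obtain ⟨a, b, i, j⟩ := z
  simp only [hooks, Finset.mem_filter, Finset.mem_product, Finset.mem_range, Finset.mem_univ,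
    and_true, Nat.lt_succ_iff, and_iff_right_iff_imp]
  rintro ⟨hba, ha, -, -⟩
  have h1 : a ≤ (S i).sup id := Finset.le_sup (f := id) ha
  have h2 : (S i).sup id ≤ Finset.univ.sup fun i => (S i).sup id :=
    Finset.le_sup (f := fun i => (S i).sup id) (Finset.mem_univ i)
  exact ⟨h1.trans h2, (hba.trans h1).trans h2⟩

/-- A `d`-hook data tuple `(c_0, …, c_{d-1}; k)` of real numbers with `k ≥ 0`. -/
structure HookData (d : ℕ) where
  c : Fin d → ℝ
  k : ℝ
  k_nonneg : 0 ≤ k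

/-- The `δ`-length `k (a - b) + c_i - c_j` of `(a, b, i, j)`. -/
noncomputable def hookLength {d : ℕ} (δ : HookData d) (z : ℕ × ℕ × Fin d × Fin d) : ℝ :=
  δ.k * ((z.1 : ℝ) - (z.2.1 : ℝ)) + δ.c z.2.2.1 - δ.c z.2.2.2

/-- The multiset of the `δ`-lengths of all hooks of `S`. -/
noncomputable def hookLengths {d : ℕ} (δ : HookData d) (S : Symbol d) : Multiset ℝ :=
  (hooks S).val.map (hookLength δ)

/-- The minimal data tuple `(0, …, 0; 1)`, which gives the usual hook lengths `a - b`. -/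
noncomputable def minimalData (d : ℕ) : HookData d := ⟨fun _ => 0, 1, zero_le_one⟩

open Classical in
/-- The multiset of the nonzero members of `M`, with their multiplicities. -/
noncomputable def nonzeroPart (M : Multiset ℝ) : Multiset ℝ := M.filter fun x => x ≠ 0

/-! ### `ℓ`-core and balanced `ℓ`-quotient -/

/-- The splitting `S_{*ℓ} = s_{dℓ}(s_d⁻¹(S))` of the `d`-symbol `S` into a `dℓ`-symbol. -/
def splitSymbol {d : ℕ} [NeZero d] (ℓ : ℕ) [NeZero ℓ] (S : Symbol d) : Symbol (d * ℓ) :=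
  symbolEquiv (d * ℓ) ((symbolEquiv d).symm S)

/-- The balanced `ℓ`-quotient `Q_ℓ(S) = Q(S_{*ℓ})`, a `dℓ`-symbol. -/
def balancedQuotientBy {d : ℕ} [NeZero d] (ℓ : ℕ) [NeZero ℓ] (S : Symbol d) : Symbol (d * ℓ) :=
  balancedQuotient (splitSymbol ℓ S)

/-- The `ℓ`-core of `S`: the `d`-symbol `C_(ℓ)(S)` with `C_(ℓ)(S)_{*ℓ} = C(S_{*ℓ})`. -/
def coreBy {d : ℕ} [NeZero d] (ℓ : ℕ) [NeZero ℓ] (S : Symbol d) : Symbol d :=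
  symbolEquiv d ((symbolEquiv (d * ℓ)).symm (core (splitSymbol ℓ S)))

/-- The `dℓ`-hook data tuple `δ_{ℓ,S}`: its entry at the position `s d + i` (with `i < d` and
`s < ℓ`) is `s + x_{i,s} ℓ`, where `x_{i,s}` is the number of elements of `X_i` that are
congruent to `s` modulo `ℓ`; its last entry is `ℓ`. -/
noncomputable def quotientData {d : ℕ} [NeZero d] (ℓ : ℕ) (S : Symbol d) :
    HookData (d * ℓ) where
  c q := (((q : ℕ) / d : ℕ) : ℝ) +
    (((S ⟨(q : ℕ) % d, Nat.mod_lt _ (NeZero.pos d)⟩).filter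
      fun a => a % ℓ = (q : ℕ) / d).card : ℝ) * (ℓ : ℝ)
  k := (ℓ : ℝ)
  k_nonneg := Nat.cast_nonneg ℓ

/-! ### The twist -/

/-- For `n = r (d ℓ) + s d + t` with `s < ℓ` and `t < d`, the number
`r (d ℓ) + s d + ((t + r e) mod d)`. -/
def twistFun (d ℓ e n : ℕ) : ℕ :=
  n / (d * ℓ) * (d * ℓ) + n / d % ℓ * d + (n % d + n / (d * ℓ) * e) % d

theorem twistFun_eq (d ℓ e r s t : ℕ) (hs : s < ℓ) (ht : t < d) :
    twistFun d ℓ e (r * (d * ℓ) + s * d + t) = r * (d * ℓ) + s * d + (t + r * e) % d := by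
  have hd : 0 < d := by omega
  have h1 : (r * (d * ℓ) + s * d + t) / d = r * ℓ + s := by
    have : r * (d * ℓ) + s * d + t = t + (r * ℓ + s) * d := by ring
    rw [this, Nat.add_mul_div_right _ _ hd, Nat.div_eq_of_lt ht, zero_add]
  have h2 : (r * (d * ℓ) + s * d + t) % d = t := by
    have : r * (d * ℓ) + s * d + t = t + (r * ℓ + s) * d := by ring
    rw [this, Nat.add_mul_mod_self_right, Nat.mod_eq_of_lt ht]
  have h3 : (r * ℓ + s) % ℓ = s := by
    rw [add_comm, Nat.add_mul_mod_self_right, Nat.mod_eq_of_lt hs]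
  have h4 : (r * ℓ + s) / ℓ = r := by
    rw [add_comm, Nat.add_mul_div_right _ _ (by omega), Nat.div_eq_of_lt hs, zero_add]
  rw [twistFun, ← Nat.div_div_eq_div_mul, h1, h2, h3, h4]

theorem twistFun_twistFun (d ℓ e f : ℕ) (hd : 0 < d) (hℓ : 0 < ℓ) (hef : e + f = d) (n : ℕ) :
    twistFun d ℓ f (twistFun d ℓ e n) = n := by
  have hn : n / d / ℓ * (d * ℓ) + n / d % ℓ * d + n % d = n := by
    have h1 := Nat.mod_add_div' n d
    have h2 := Nat.mod_add_div' (n / d) ℓ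
    calc n / d / ℓ * (d * ℓ) + n / d % ℓ * d + n % d
        = n % d + (n / d % ℓ + n / d / ℓ * ℓ) * d := by ring
      _ = n := by rw [h2, h1]
  have hs : n / d % ℓ < ℓ := Nat.mod_lt _ hℓ
  have ht : n % d < d := Nat.mod_lt _ hd
  rw [← hn, twistFun_eq d ℓ e _ _ _ hs ht, twistFun_eq d ℓ f _ _ _ hs (Nat.mod_lt _ hd)]
  congr 1
  rw [Nat.mod_add_mod, add_assoc, ← mul_add, hef, Nat.add_mul_mod_self_right,
    Nat.mod_eq_of_lt ht]

/-- The permutation `σ_{d,ℓ,e}` of `ℕ`. -/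
def twistPerm (d ℓ : ℕ) [NeZero d] [NeZero ℓ] (e : Fin d) : Equiv.Perm ℕ where
  toFun n := twistFun d ℓ e n
  invFun n := twistFun d ℓ (d - e) n
  left_inv n := twistFun_twistFun d ℓ e (d - e) (NeZero.pos d) (NeZero.pos ℓ) (by omega) n
  right_inv n := twistFun_twistFun d ℓ (d - e) e (NeZero.pos d) (NeZero.pos ℓ) (by omega) n

/-- The `(ℓ, e)`-twist `S ↦ σ(S) = s_d(σ(s_d⁻¹(S)))`, a bijection of the set of `d`-symbols. -/
def symbolTwist {d : ℕ} [NeZero d] (ℓ : ℕ) [NeZero ℓ] (e : Fin d) : Equiv.Perm (Symbol d) :=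
  (symbolEquiv d).symm.trans ((Equiv.finsetCongr (twistPerm d ℓ e)).trans (symbolEquiv d))

/-- The `(ℓ, e)`-core of `S`: the `d`-symbol `C_(ℓ,e)(S)` with
`σ(C_(ℓ,e)(S)) = C_(ℓ)(σ(S))`. -/
def twistedCore {d : ℕ} [NeZero d] (ℓ : ℕ) [NeZero ℓ] (e : Fin d) (S : Symbol d) : Symbol d :=
  (symbolTwist ℓ e).symm (coreBy ℓ (symbolTwist ℓ e S))

/-- The balanced `(ℓ, e)`-quotient `Q_{ℓ,e}(S) = Q(σ(S)_{*ℓ})`, a `dℓ`-symbol. -/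
def twistedQuotient {d : ℕ} [NeZero d] (ℓ : ℕ) [NeZero ℓ] (e : Fin d) (S : Symbol d) :
    Symbol (d * ℓ) :=
  balancedQuotientBy ℓ (symbolTwist ℓ e S)

end DSymb

namespace DSymb

/-! The twist moves an entry `a` only between components, so it preserves nonzero lengths `a - b`;
this reduces everything to the untwisted case. There, split `S` into `Z = S_{*ℓ}`. Hooks of `S` of
length `h > 0` are pairs `(z, w)` with `z` in `Z q`, `w` outside `Z q'` and `ℓ (z - w) + s - t = h`,
where `s = q / d` and `t = q' / d` (`card_hooks_eq_sum_splitCount`). Adjoining all negative integers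
to each component makes these counts translation invariant. The balanced quotient translates each
component of `Z`, and the charges in `δ` compensate, so its hooks of `δ`-length `f` are the same
pairs, kept only for those `(q, q', f)` satisfying `IsQuotientHook`
(`card_hooks_balancedQuotientBy`).

The count for `(q, q', h)` minus that for `(q', q, -h)` depends only on cardinalities, so `Z` and
its core agree on it. For `h ≠ 0` exactly one of the two triples satisfies `IsQuotientHook`, and the
core has no pairs for that one. Hence each count for `Z` is a quotient term of length `h` or `-h`
plus a core term (`splitCount_eq_add`); summing over `q, q'` gives the theorem. -/

/-- The Maya diagram of a beta-set: the beta-set together with all negative integers. -/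
def maya (X : Finset ℕ) : Set ℤ := {z | z < 0 ∨ ∃ n ∈ X, (n : ℤ) = z}

theorem natCast_mem_maya {X : Finset ℕ} {n : ℕ} : (n : ℤ) ∈ maya X ↔ n ∈ X := by
  constructor
  · rintro (h | ⟨m, hm, h⟩)
    · omega
    · rwa [← Int.ofNat_inj.1 h]
  · exact fun h => Or.inr ⟨n, h, rfl⟩

theorem mem_maya_range {x : ℕ} {z : ℤ} : z ∈ maya (Finset.range x) ↔ z < x := by
  constructor
  · rintro (h | ⟨m, hm, rfl⟩)
    · omega
    · exact_mod_cast Finset.mem_range.1 hm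
  · intro h
    by_cases h0 : z < 0
    · exact Or.inl h0
    · lift z to ℕ using by omega
      exact natCast_mem_maya.2 (Finset.mem_range.2 (by omega))

theorem nonneg_of_notMem_maya {X : Finset ℕ} {z : ℤ} (h : z ∉ maya X) : 0 ≤ z := by
  by_contra h0
  exact h (Or.inl (by omega))

/-! ### Counting pairs between Maya diagrams -/

/-- The number of pairs `(z, w)` with `z ∈ A`, `w ∉ B` and `ℓ (z - w) + s - t = h`. -/
noncomputable def pairCount (A B : Set ℤ) (ℓ s t h : ℤ) : ℕ :=
  Set.ncard {p : ℤ × ℤ | p.1 ∈ A ∧ p.2 ∉ B ∧ ℓ * (p.1 - p.2) + s - t = h}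

theorem pairCount_eq_ncard {A B : Set ℤ} {ℓ s t h k : ℤ} (hℓ : 0 < ℓ) (hk : ℓ * k + s - t = h) :
    pairCount A B ℓ s t h = Set.ncard {z : ℤ | z ∈ A ∧ z - k ∉ B} := by
  have hinj : Function.Injective fun z : ℤ => (z, z - k) := fun a b hab => congrArg Prod.fst hab
  rw [pairCount, ← Set.ncard_image_of_injective _ hinj]
  congr 1
  ext ⟨z, w⟩
  simp only [Set.mem_ofPred_eq, Set.mem_image, Prod.mk.injEq]
  constructor
  · rintro ⟨h1, h2, h3⟩
    have h4 : z - w = k := mul_left_cancel₀ hℓ.ne' (by linarith)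
    have h5 : z - k = w := by omega
    exact ⟨z, ⟨h1, by rwa [h5]⟩, rfl, h5⟩
  · rintro ⟨a, ⟨h1, h2⟩, rfl, rfl⟩
    refine ⟨h1, h2, ?_⟩
    rw [← hk]
    ring

theorem pairCount_eq_zero_of_forall {A B : Set ℤ} {ℓ s t h : ℤ}
    (hk : ∀ k, ℓ * k + s - t ≠ h) : pairCount A B ℓ s t h = 0 := by
  rw [pairCount, Set.eq_empty_of_forall_notMem (s := {p : ℤ × ℤ | _}), Set.ncard_empty]
  rintro ⟨z, w⟩ ⟨-, -, h3⟩
  exact hk _ h3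

/-- The part of the Maya diagram of `X`, moved by `k`, that lies in `[-N, ∞)`. -/
noncomputable def truncatedMaya (N k : ℤ) (X : Finset ℕ) : Finset ℤ :=
  Finset.Ico (-N) k ∪ X.image fun n : ℕ => (n : ℤ) + k

theorem card_truncatedMaya {N k : ℤ} (h : -N ≤ k) (X : Finset ℕ) :
    ((truncatedMaya N k X).card : ℤ) = N + k + X.card := by
  rw [truncatedMaya, Finset.card_union_of_disjoint, Finset.card_image_of_injective,
    Int.card_Ico]
  · push_cast
    omega
  · intro a b hab
    simpa using hab
  · rw [Finset.disjoint_left]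
    intro a ha hb
    obtain ⟨n, -, rfl⟩ := Finset.mem_image.1 hb
    have := Finset.mem_Ico.1 ha
    omega

theorem mem_truncatedMaya {N k z : ℤ} (X : Finset ℕ) (h : -N ≤ k) :
    z ∈ truncatedMaya N k X ↔ -N ≤ z ∧ z - k ∈ maya X := by
  simp only [truncatedMaya, Finset.mem_union, Finset.mem_Ico, Finset.mem_image, maya,
    Set.mem_ofPred_eq]
  constructor
  · rintro (⟨h1, h2⟩ | ⟨n, hn, rfl⟩)
    · exact ⟨h1, Or.inl (by omega)⟩
    · exact ⟨by omega, Or.inr ⟨n, hn, by omega⟩⟩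
  · rintro ⟨h1, h2 | ⟨n, hn, h3⟩⟩
    · exact Or.inl ⟨h1, by omega⟩
    · exact Or.inr ⟨n, hn, by omega⟩

/-- Above `-|k|` both diagrams become finite sets `A`, `B`, and nothing is lost, since below it both
contain everything. The claim is then `|A \ B| - |B \ A| = |A| - |B|`. -/
theorem ncard_maya_sub_ncard_maya (X Y : Finset ℕ) (k : ℤ) :
    (Set.ncard {z : ℤ | z ∈ maya X ∧ z - k ∉ maya Y} : ℤ) -
      Set.ncard {z : ℤ | z ∈ maya Y ∧ z - (-k) ∉ maya X} = X.card - Y.card - k := by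
  set A := truncatedMaya |k| 0 X with hA
  set B := truncatedMaya |k| k Y with hB
  have h0 : -|k| ≤ 0 := by simp
  have hk : -|k| ≤ k := neg_abs_le k
  have h1 : {z : ℤ | z ∈ maya X ∧ z - k ∉ maya Y} = ((A \ B : Finset ℤ) : Set ℤ) := by
    ext z
    simp only [Set.mem_ofPred_eq, Finset.coe_sdiff, Set.mem_sdiff, Finset.mem_coe, hA, hB,
      mem_truncatedMaya X h0, mem_truncatedMaya Y hk, sub_zero]
    constructor
    · rintro ⟨hx, hy⟩
      have := nonneg_of_notMem_maya hy
      exact ⟨⟨by omega, hx⟩, fun h => hy h.2⟩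
    · rintro ⟨⟨h3, h4⟩, h5⟩
      exact ⟨h4, fun h => h5 ⟨h3, h⟩⟩
  have h2 : Set.ncard {z : ℤ | z ∈ maya Y ∧ z - (-k) ∉ maya X} = (B \ A).card := by
    rw [← Set.ncard_coe_finset, ← Set.ncard_image_of_injective _ (add_left_injective k)]
    congr 1
    ext z
    simp only [Set.mem_image, Set.mem_ofPred_eq, Finset.coe_sdiff, Set.mem_sdiff, Finset.mem_coe,
      hA, hB, mem_truncatedMaya X h0, mem_truncatedMaya Y hk, sub_zero]
    constructor
    · rintro ⟨w, ⟨hy, hx⟩, rfl⟩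
      rw [sub_neg_eq_add] at hx
      have := nonneg_of_notMem_maya hx
      exact ⟨⟨by omega, by simpa using hy⟩, fun h => hx h.2⟩
    · rintro ⟨⟨h3, h4⟩, h5⟩
      exact ⟨z - k, ⟨h4, fun h => h5 ⟨h3, by simpa using h⟩⟩, by ring⟩
  rw [h1, h2, Set.ncard_coe_finset]
  have h3 := Finset.card_sdiff_add_card_inter A B
  have h4 := Finset.card_sdiff_add_card_inter B A
  rw [Finset.inter_comm] at h4
  have h5 := card_truncatedMaya h0 X
  have h6 := card_truncatedMaya hk Y
  rw [← hA] at h5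
  rw [← hB] at h6
  omega

/-- The difference of the two opposite counts sees only cardinalities, which passing to the core
preserves. It is stated additively to stay in `ℕ`. -/
theorem pairCount_add_pairCount_core (X Y : Finset ℕ) {ℓ : ℤ} (hℓ : 0 < ℓ) (s t h : ℤ) :
    pairCount (maya X) (maya Y) ℓ s t h +
        pairCount (maya (Finset.range Y.card)) (maya (Finset.range X.card)) ℓ t s (-h) =
      pairCount (maya (Finset.range X.card)) (maya (Finset.range Y.card)) ℓ s t h +
        pairCount (maya Y) (maya X) ℓ t s (-h) := by
  by_cases hk : ∃ k, ℓ * k + s - t = h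
  · obtain ⟨k, hk⟩ := hk
    have hk' : ℓ * (-k) + t - s = -h := by linarith
    simp only [pairCount_eq_ncard hℓ hk, pairCount_eq_ncard hℓ hk']
    have h1 := ncard_maya_sub_ncard_maya X Y k
    have h2 := ncard_maya_sub_ncard_maya (Finset.range X.card) (Finset.range Y.card) k
    rw [Finset.card_range, Finset.card_range] at h2
    omega
  · push Not at hk
    have hk' : ∀ k, ℓ * k + t - s ≠ -h := fun k h1 => hk (-k) (by linarith)
    simp only [pairCount_eq_zero_of_forall hk, pairCount_eq_zero_of_forall hk']

/-- The diagrams are rays, so `z < x` and `w ≥ y` force `z - w < x - y`. -/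
theorem pairCount_range_eq_zero {x y : ℕ} {ℓ s t h : ℤ} (hℓ : 0 < ℓ)
    (hh : (s + x * ℓ) - (t + y * ℓ) ≤ h) :
    pairCount (maya (Finset.range x)) (maya (Finset.range y)) ℓ s t h = 0 := by
  rw [pairCount, Set.eq_empty_of_forall_notMem (s := {p : ℤ × ℤ | _}), Set.ncard_empty]
  rintro ⟨z, w⟩ ⟨h1, h2, h3⟩
  simp only [mem_maya_range] at h1 h2 h3
  have : ℓ * (z - w) < ℓ * (x - y) := mul_lt_mul_of_pos_left (by omega) hℓ
  have h4 : ℓ * ((x : ℤ) - y) = x * ℓ - y * ℓ := by ring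
  exact absurd hh (by omega)

theorem pairCount_shift {A B A' B' : Set ℤ} {u v ℓ s t h : ℤ} (hA : ∀ z, z ∈ A' ↔ z + u ∈ A)
    (hB : ∀ z, z ∈ B' ↔ z + v ∈ B) :
    pairCount A' B' ℓ (s + ℓ * u) (t + ℓ * v) h = pairCount A B ℓ s t h := by
  have hinj : Function.Injective fun p : ℤ × ℤ => (p.1 + u, p.2 + v) := by
    rintro ⟨a, b⟩ ⟨c, d⟩ h
    simpa using h
  rw [pairCount, pairCount, ← Set.ncard_image_of_injective _ hinj]
  congr 1
  ext ⟨z, w⟩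
  simp only [Set.mem_image, Set.mem_ofPred_eq, Prod.mk.injEq, Prod.exists, hA, hB]
  constructor
  · rintro ⟨a, b, ⟨h1, h2, h3⟩, rfl, rfl⟩
    exact ⟨h1, h2, by rw [← h3]; ring⟩
  · rintro ⟨h1, h2, h3⟩
    refine ⟨z - u, w - v, ⟨by simpa using h1, by simpa using h2, ?_⟩, by ring, by ring⟩
    rw [← h3]
    ring

/-! ### Beta-sets of a partition -/

/-- The `i`-th largest part of a partition, or `0`. -/
def nthPart (κ : Σ n : ℕ, n.Partition) (i : ℕ) : ℕ := (κ.2.parts.sort (· ≥ ·)).getD i 0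

theorem nthPart_of_le {κ : Σ n : ℕ, n.Partition} {i : ℕ} (h : numParts κ ≤ i) :
    nthPart κ i = 0 := by
  rw [nthPart, List.getD_eq_default]
  simpa [numParts] using h

theorem parts_partition (X : Finset ℕ) :
    (partition X).2.parts = (shiftedParts X).filter (· ≠ 0) := rfl

theorem shiftedParts_insert {X : Finset ℕ} {a : ℕ} (h : ∀ x ∈ X, x < a) :
    shiftedParts (insert a X) = (a - X.card) ::ₘ shiftedParts X := by
  have ha : a ∉ X := fun h1 => lt_irrefl _ (h a h1)
  rw [shiftedParts, Finset.insert_val_of_notMem ha, Multiset.map_cons, shiftedParts]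
  congr 1
  · rw [Finset.filter_insert, if_neg (lt_irrefl a), Finset.filter_true_of_mem h]
  · refine Multiset.map_congr rfl fun b hb => ?_
    rw [Finset.filter_insert, if_neg (not_lt.2 (h b hb).le)]

/-- The elements of `X` from `b` on lie in `[b, a)`, so there are at most `a - b` of them. Thus a
new maximum contributes the largest part. -/
theorem le_of_mem_shiftedParts {X : Finset ℕ} {a m : ℕ} (h : ∀ x ∈ X, x < a)
    (hm : m ∈ shiftedParts X) : m ≤ a - X.card := by
  obtain ⟨b, hb, rfl⟩ := Multiset.mem_map.1 hm
  have h1 : (X.filter fun x => ¬ x < b).card ≤ (Finset.Ico b a).card := by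
    refine Finset.card_le_card fun x hx => ?_
    rw [Finset.mem_filter] at hx
    exact Finset.mem_Ico.2 ⟨not_lt.1 hx.2, h x hx.1⟩
  have h2 := Finset.card_filter_add_card_filter_not (s := X) (fun x => x < b)
  have h3 := h b hb
  rw [Nat.card_Ico] at h1
  omega

theorem nthPart_partition_insert {X : Finset ℕ} {a : ℕ} (h : ∀ x ∈ X, x < a) :
    nthPart (partition (insert a X)) 0 = a - X.card ∧
      ∀ i, nthPart (partition (insert a X)) (i + 1) = nthPart (partition X) i := by
  simp only [nthPart, parts_partition, shiftedParts_insert h]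
  -- Zero parts are discarded; if the new, largest part is zero, then so are all the others.
  by_cases h0 : a - X.card = 0
  · have h1 : (shiftedParts X).filter (· ≠ 0) = 0 := by
      rw [Multiset.filter_eq_nil]
      intro m hm hne
      have := le_of_mem_shiftedParts h hm
      omega
    rw [Multiset.filter_cons_of_neg (p := fun m => m ≠ 0) _ (not_not.2 h0), h1]
    simp [h0]
  · rw [Multiset.filter_cons_of_pos (p := fun m => m ≠ 0) _ h0, Multiset.sort_cons]
    · simp
    · intro m hm
      exact le_of_mem_shiftedParts h (Multiset.mem_filter.1 hm).1

theorem card_le_of_forall_lt {X : Finset ℕ} {a : ℕ} (h : ∀ x ∈ X, x < a) : X.card ≤ a := by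
  simpa using Finset.card_le_card (fun x hx => Finset.mem_range.2 (h x hx) : X ⊆ Finset.range a)

theorem mem_maya_insert {X : Finset ℕ} {a : ℕ} {z : ℤ} :
    z ∈ maya (insert a X) ↔ z = a ∨ z ∈ maya X := by
  simp only [maya, Set.mem_ofPred_eq, Finset.exists_mem_insert]
  tauto

/-- The partition lists the diagram in decreasing order up to a shift by the cardinality; the zeros
past its last part produce the remaining ray. Induction adds a new maximum. -/
theorem mem_maya_iff_exists_nthPart (X : Finset ℕ) : ∀ z : ℤ,
    z ∈ maya X ↔ ∃ i : ℕ, z = nthPart (partition X) i + X.card - 1 - i := by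
  induction X using Finset.induction_on_max with
  | empty =>
    intro z
    have h : ∀ i, nthPart (partition ∅) i = 0 := fun i => nthPart_of_le (Nat.zero_le i)
    simp only [h, maya, Set.mem_ofPred_eq, Finset.notMem_empty, false_and, exists_false, or_false,
      Finset.card_empty]
    constructor
    · exact fun hz => ⟨(-z - 1).toNat, by omega⟩
    · rintro ⟨i, hi⟩
      omega
  | insert a X h ih =>
    intro z
    obtain ⟨h1, h2⟩ := nthPart_partition_insert h
    have ha : a ∉ X := fun h1 => lt_irrefl _ (h a h1)
    have h3 := card_le_of_forall_lt h
    rw [mem_maya_insert, ih, Finset.card_insert_of_notMem ha]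
    constructor
    · rintro (rfl | ⟨i, hi⟩)
      · exact ⟨0, by rw [h1]; omega⟩
      · exact ⟨i + 1, by rw [h2]; omega⟩
    · rintro ⟨_ | i, hi⟩
      · left
        rw [h1] at hi
        omega
      · right
        rw [h2] at hi
        exact ⟨i, by omega⟩

theorem mem_maya_betaSet {κ : Σ n : ℕ, n.Partition} {r : ℕ} (h : numParts κ ≤ r) (z : ℤ) :
    z ∈ maya (betaSet κ r) ↔ ∃ i : ℕ, z = nthPart κ i + r - 1 - i := by
  have hmem : ∀ n, n ∈ betaSet κ r ↔ ∃ i < r, nthPart κ i + (r - 1 - i) = n := by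
    intro n
    simp only [betaSet, Finset.mem_image, Finset.mem_range, nthPart]
  simp only [maya, Set.mem_ofPred_eq, hmem]
  constructor
  · rintro (hz | ⟨n, ⟨i, hi, rfl⟩, rfl⟩)
    · refine ⟨(r - 1 - z).toNat, ?_⟩
      rw [nthPart_of_le (by omega)]
      omega
    · exact ⟨i, by omega⟩
  · rintro ⟨i, rfl⟩
    by_cases hi : i < r
    · exact Or.inr ⟨_, ⟨i, hi, rfl⟩, by omega⟩
    · left
      rw [nthPart_of_le (by omega)]
      omega

/-- Both diagrams come from the same partition and differ by a shift. As `r` is common to all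
components, it cancels in differences. -/
theorem mem_maya_balancedQuotient {d : ℕ} (Z : Symbol d) : ∃ r : ℤ, ∀ q z,
    z ∈ maya (balancedQuotient Z q) ↔ z + ((Z q).card - r) ∈ maya (Z q) := by
  refine ⟨((Finset.univ.sup fun j => numParts (partition (Z j)) : ℕ) : ℤ), fun q z => ?_⟩
  rw [mem_maya_iff_exists_nthPart (Z q), balancedQuotient, balancedSymbol, mem_maya_betaSet
    (Finset.le_sup (f := fun j => numParts (partition (Z j))) (Finset.mem_univ q))]
  refine exists_congr fun i => ?_
  constructor <;> intro h <;> omega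


/-! ### Counting by pairs of components -/

theorem card_eq_sum_ncard {α β ι : Type*} [Fintype ι] (F : Finset α)
    (φ : α → β × ι × ι) (hφ : Set.InjOn φ F) (P : ι → ι → Set β)
    (hP : ∀ b q q', b ∈ P q q' ↔ ∃ z ∈ F, φ z = (b, q, q')) :
    F.card = ∑ q, ∑ q', (P q q').ncard := by
  classical
  rw [← Fintype.sum_prod_type' (f := fun q q' => (P q q').ncard),
    Finset.card_eq_sum_card_fiberwise (f := fun z => (φ z).2) (t := Finset.univ)
      (fun _ _ => Finset.mem_coe.2 (Finset.mem_univ _))]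
  refine Finset.sum_congr rfl fun p _ => ?_
  obtain ⟨q, q'⟩ := p
  have h : P q q' = (fun z => (φ z).1) '' (F.filter fun z => (φ z).2 = (q, q') : Finset α) := by
    ext b
    simp only [hP, Set.mem_image, Finset.mem_coe, Finset.mem_filter]
    constructor
    · rintro ⟨z, hz, h⟩
      exact ⟨z, ⟨hz, by rw [h]⟩, by rw [h]⟩
    · rintro ⟨z, ⟨hz, h⟩, rfl⟩
      exact ⟨z, hz, Prod.ext rfl h⟩
  rw [h, Set.InjOn.ncard_image, Set.ncard_coe_finset]
  intro z hz w hw hzw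
  rw [Finset.mem_coe, Finset.mem_filter] at hz hw
  exact hφ hz.1 hw.1 (Prod.ext hzw (hz.2.trans hw.2.symm))

theorem mem_assemble {d : ℕ} [NeZero d] {S : Symbol d} {j : Fin d} {k : ℕ} :
    (j : ℕ) + k * d ∈ assemble d S ↔ k ∈ S j := by
  rw [← mem_component]
  exact iff_of_eq (congrArg (k ∈ ·) (congrFun ((symbolEquiv d).apply_symm_apply S) j))

theorem hookLength_minimalData {d : ℕ} (z : ℕ × ℕ × Fin d × Fin d) :
    hookLength (minimalData d) z = (z.1 : ℝ) - z.2.1 := by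
  simp [hookLength, minimalData]

/-! ### Splitting -/

theorem div_lt_of_fin_mul {d ℓ : ℕ} (q : Fin (d * ℓ)) : (q : ℕ) / d < ℓ :=
  Nat.div_lt_of_lt_mul q.2

section Split

variable {d ℓ : ℕ} [NeZero d] [NeZero ℓ]

/-- The component of `S` which the `q`-th component of `splitSymbol ℓ S` comes from. -/
def splitComponent (q : Fin (d * ℓ)) : Fin d := ⟨(q : ℕ) % d, Nat.mod_lt _ (NeZero.pos d)⟩

theorem mem_splitSymbol {S : Symbol d} {q : Fin (d * ℓ)} {r : ℕ} :
    r ∈ splitSymbol ℓ S q ↔ r * ℓ + q / d ∈ S (splitComponent q) := by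
  have h : (q : ℕ) + r * (d * ℓ) = (splitComponent q : ℕ) + (r * ℓ + q / d) * d := by
    have := Nat.mod_add_div' (q : ℕ) d
    calc (q : ℕ) + r * (d * ℓ) = q % d + q / d * d + r * (d * ℓ) := by rw [this]
      _ = _ := by simp only [splitComponent]; ring
  rw [← mem_assemble (S := S), ← h]
  exact mem_component

/-- The component of `splitSymbol ℓ S` which the entry `a` of the `i`-th component of `S`
goes to. -/
def splitIndex (a : ℕ) (i : Fin d) : Fin (d * ℓ) :=
  ⟨a % ℓ * d + i, by
    have h1 : a % ℓ + 1 ≤ ℓ := Nat.mod_lt _ (NeZero.pos ℓ)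
    calc a % ℓ * d + i < (a % ℓ + 1) * d := by rw [add_mul, one_mul]; omega
      _ ≤ ℓ * d := Nat.mul_le_mul_right d h1
      _ = d * ℓ := mul_comm _ _⟩

theorem splitIndex_div (a : ℕ) (i : Fin d) : (splitIndex a i : Fin (d * ℓ)) / d = a % ℓ := by
  simp only [splitIndex]
  rw [add_comm, Nat.add_mul_div_right _ _ (NeZero.pos d), Nat.div_eq_of_lt i.2, zero_add]

theorem splitComponent_splitIndex (a : ℕ) (i : Fin d) :
    splitComponent (splitIndex a i : Fin (d * ℓ)) = i := by
  ext
  simp only [splitIndex, splitComponent]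
  rw [add_comm, Nat.add_mul_mod_self_right, Nat.mod_eq_of_lt i.2]

theorem splitIndex_splitComponent (r : ℕ) (q : Fin (d * ℓ)) :
    splitIndex (r * ℓ + q / d) (splitComponent q) = q := by
  ext
  simp only [splitIndex, splitComponent]
  rw [add_comm (r * ℓ), Nat.add_mul_mod_self_right, Nat.mod_eq_of_lt (div_lt_of_fin_mul q)]
  exact Nat.div_add_mod' _ _

theorem mem_splitSymbol_splitIndex {S : Symbol d} {a : ℕ} {i : Fin d} :
    a / ℓ ∈ splitSymbol ℓ S (splitIndex a i) ↔ a ∈ S i := by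
  rw [mem_splitSymbol, splitIndex_div, splitComponent_splitIndex, Nat.div_add_mod']

theorem splitIndex_injective {a b : ℕ} {i j : Fin d} (h : a / ℓ = b / ℓ)
    (h' : (splitIndex a i : Fin (d * ℓ)) = splitIndex b j) : a = b ∧ i = j := by
  refine ⟨?_, ?_⟩
  · rw [← Nat.div_add_mod' a ℓ, ← Nat.div_add_mod' b ℓ, h, ← splitIndex_div a i, h',
      splitIndex_div]
  · rw [← splitComponent_splitIndex (ℓ := ℓ) a i, h', splitComponent_splitIndex]

theorem card_splitSymbol (S : Symbol d) (q : Fin (d * ℓ)) :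
    ((S (splitComponent q)).filter fun a => a % ℓ = q / d).card = (splitSymbol ℓ S q).card := by
  have hℓ : 0 < ℓ := NeZero.pos ℓ
  refine Finset.card_bij (fun a _ => a / ℓ) ?_ ?_ ?_
  · intro a ha
    rw [Finset.mem_filter] at ha
    rw [mem_splitSymbol, ← ha.2, Nat.div_add_mod']
    exact ha.1
  · intro a ha b hb h
    rw [Finset.mem_filter] at ha hb
    rw [← Nat.div_add_mod' a ℓ, ← Nat.div_add_mod' b ℓ, h, ha.2, hb.2]
  · intro r hr
    refine ⟨r * ℓ + q / d, Finset.mem_filter.2 ⟨mem_splitSymbol.1 hr, ?_⟩, ?_⟩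
    · rw [add_comm, Nat.add_mul_mod_self_right, Nat.mod_eq_of_lt (div_lt_of_fin_mul q)]
    · rw [add_comm, Nat.add_mul_div_right _ _ hℓ, Nat.div_eq_of_lt (div_lt_of_fin_mul q),
        zero_add]

theorem splitSymbol_coreBy (S : Symbol d) :
    splitSymbol ℓ (coreBy ℓ S) = core (splitSymbol ℓ S) := by
  rw [splitSymbol, coreBy, Equiv.symm_apply_apply, Equiv.apply_symm_apply]

/-! ### Hooks of a symbol counted on its splitting -/

/-- The number of pairs `(z, w)` with `z` in the Maya diagram of `Z q`, `w` not in that of `Z q'`,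
for which the corresponding hook of the symbol that `Z` splits has length `f`. -/
noncomputable def splitCount (Z : Symbol (d * ℓ)) (q q' : Fin (d * ℓ)) (f : ℤ) : ℕ :=
  pairCount (maya (Z q)) (maya (Z q')) ℓ ((q : ℕ) / d : ℕ) ((q' : ℕ) / d : ℕ) f

theorem card_hooks_eq_sum_splitCount (S : Symbol d) {h : ℕ} (hh : 0 < h) :
    ((hooks S).filter fun z => hookLength (minimalData d) z = h).card =
      ∑ q, ∑ q', splitCount (splitSymbol ℓ S) q q' h := by
  have hℓ : (0 : ℤ) < ℓ := by exact_mod_cast NeZero.pos ℓ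
  have hlen : ∀ z : ℕ × ℕ × Fin d × Fin d,
      hookLength (minimalData d) z = h ↔ (z.1 : ℤ) - z.2.1 = h := by
    intro z
    rw [hookLength_minimalData]
    exact_mod_cast Iff.rfl
  refine card_eq_sum_ncard (β := ℤ × ℤ) (ι := Fin (d * ℓ)) _ (fun z : ℕ × ℕ × Fin d × Fin d =>
    (((z.1 / ℓ : ℕ), (z.2.1 / ℓ : ℕ)), splitIndex z.1 z.2.2.1, splitIndex z.2.1 z.2.2.2)) ?_ _ ?_
  · rintro ⟨a, b, i, j⟩ - ⟨a', b', i', j'⟩ - h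
    simp only [Prod.mk.injEq, Int.ofNat_inj] at h
    obtain ⟨⟨h1, h2⟩, h3, h4⟩ := h
    obtain ⟨rfl, rfl⟩ := splitIndex_injective h1 h3
    obtain ⟨rfl, rfl⟩ := splitIndex_injective h2 h4
    rfl
  · rintro ⟨z, w⟩ q q'
    simp only [Set.mem_ofPred_eq, Finset.mem_filter, mem_hooks, hlen, Prod.mk.injEq, Prod.exists,
      IsHook]
    constructor
    · rintro ⟨h1, h2, h3⟩
      have hw := nonneg_of_notMem_maya h2
      have hq' := div_lt_of_fin_mul q'
      have hq := div_lt_of_fin_mul q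
      have hq0 : (0 : ℤ) ≤ ((q' : ℕ) / d : ℕ) := Int.natCast_nonneg _
      -- No spurious pair uses a negative integer: `w ≥ 0` as it is outside a diagram, and `z - w ≤
      -- -1` would give a negative length because `q / d < ℓ`.
      have hzw : -1 < z - w := by
        by_contra hc
        have : (ℓ : ℤ) * (z - w) ≤ ℓ * (-1) := mul_le_mul_of_nonneg_left (by omega) hℓ.le
        omega
      lift w to ℕ using hw
      lift z to ℕ using by omega
      rw [natCast_mem_maya, mem_splitSymbol] at h1 h2
      have h4 : ((z * ℓ + q / d : ℕ) : ℤ) - ((w * ℓ + q' / d : ℕ) : ℤ) = h := by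
        rw [← h3]
        push_cast
        ring
      refine ⟨z * ℓ + q / d, w * ℓ + q' / d, splitComponent q, splitComponent q',
        ⟨⟨by omega, h1, h2, fun h5 => by omega⟩, h4⟩, ⟨?_, ?_⟩, splitIndex_splitComponent _ _,
        splitIndex_splitComponent _ _⟩
      · rw [add_comm, Nat.add_mul_div_right _ _ (NeZero.pos ℓ), Nat.div_eq_of_lt hq, zero_add]
      · rw [add_comm, Nat.add_mul_div_right _ _ (NeZero.pos ℓ), Nat.div_eq_of_lt hq', zero_add]
    · rintro ⟨a, b, i, j, ⟨⟨-, ha, hb, -⟩, hab⟩, ⟨rfl, rfl⟩, rfl, rfl⟩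
      refine ⟨natCast_mem_maya.2 (mem_splitSymbol_splitIndex.2 ha),
        fun h => hb (mem_splitSymbol_splitIndex.1 (natCast_mem_maya.1 h)), ?_⟩
      rw [splitIndex_div, splitIndex_div, ← hab]
      have h1 : ((a / ℓ : ℕ) : ℤ) * ℓ + (a % ℓ : ℕ) = a := by
        exact_mod_cast Nat.div_add_mod' a ℓ
      have h2 : ((b / ℓ : ℕ) : ℤ) * ℓ + (b % ℓ : ℕ) = b := by
        exact_mod_cast Nat.div_add_mod' b ℓ
      linear_combination h1 - h2

/-! ### Hooks of the balanced quotient -/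

/-- The entries of `quotientData ℓ S` as integers, in terms of `Z = splitSymbol ℓ S`. -/
def charge (Z : Symbol (d * ℓ)) (q : Fin (d * ℓ)) : ℤ :=
  ((q : ℕ) / d : ℕ) + (Z q).card * ℓ

theorem quotientData_c (S : Symbol d) (q : Fin (d * ℓ)) :
    (quotientData ℓ S).c q = charge (splitSymbol ℓ S) q := by
  rw [charge, ← card_splitSymbol]
  push_cast
  rfl

theorem hookLength_quotientData (S : Symbol d) (z : ℕ × ℕ × Fin (d * ℓ) × Fin (d * ℓ)) :
    hookLength (quotientData ℓ S) z =
      ((ℓ * ((z.1 : ℤ) - z.2.1) + charge (splitSymbol ℓ S) z.2.2.1 -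
        charge (splitSymbol ℓ S) z.2.2.2 : ℤ) : ℝ) := by
  rw [hookLength, quotientData_c, quotientData_c]
  push_cast
  rfl

/-- Whether the pairs counted by `splitCount Z q q' f` give hooks of the balanced quotient. -/
def IsQuotientHook (Z : Symbol (d * ℓ)) (q q' : Fin (d * ℓ)) (f : ℤ) : Prop :=
  charge Z q - charge Z q' < f ∨ (charge Z q - charge Z q' = f ∧ q' < q)

-- For a pair of length `f`, `ℓ (z - w)` equals `f` minus the charge difference. Whether the pair is
-- a hook therefore depends only on `q`, `q'` and `f`.
open Classical in
theorem card_hooks_balancedQuotientBy (S : Symbol d) (f : ℤ) :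
    ((hooks (balancedQuotientBy ℓ S)).filter fun z => hookLength (quotientData ℓ S) z = f).card =
      ∑ q, ∑ q', if IsQuotientHook (splitSymbol ℓ S) q q' f then
        splitCount (splitSymbol ℓ S) q q' f else 0 := by
  have hℓ : (0 : ℤ) < ℓ := by exact_mod_cast NeZero.pos ℓ
  obtain ⟨r, hr⟩ := mem_maya_balancedQuotient (splitSymbol ℓ S)
  set Z := splitSymbol ℓ S with hZ
  set Y := balancedQuotientBy ℓ S with hY
  have hlen : ∀ z : ℕ × ℕ × Fin (d * ℓ) × Fin (d * ℓ), hookLength (quotientData ℓ S) z = f ↔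
      ℓ * ((z.1 : ℤ) - z.2.1) + charge Z z.2.2.1 - charge Z z.2.2.2 = f := by
    intro z
    rw [hookLength_quotientData]
    exact_mod_cast Iff.rfl
  rw [card_eq_sum_ncard _ (fun z => (((z.1 : ℤ), (z.2.1 : ℤ)), z.2.2.1, z.2.2.2)) ?_
    (fun q q' => {p : ℤ × ℤ | IsQuotientHook Z q q' f ∧ p.1 ∈ maya (Y q) ∧ p.2 ∉ maya (Y q') ∧
      ℓ * (p.1 - p.2) + charge Z q - charge Z q' = f}) ?_]
  · refine Finset.sum_congr rfl fun q _ => Finset.sum_congr rfl fun q' _ => ?_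
    split_ifs with hH
    · simp only [hH, true_and]
      -- Shifting component `q` by `|Z q| - r` turns its offset `q / d` into its charge minus `r ℓ`.
      rw [splitCount, ← pairCount_shift (hr q) (hr q'), pairCount]
      congr 1
      ext p
      simp only [Set.mem_ofPred_eq, charge]
      refine and_congr_right fun _ => and_congr_right fun _ => ?_
      constructor <;> intro h <;> rw [← h] <;> ring
    · simp [hH]
  · rintro ⟨a, b, i, j⟩ - ⟨a', b', i', j'⟩ - h
    simpa [and_assoc] using h
  · rintro ⟨z, w⟩ q q'
    simp only [Set.mem_ofPred_eq, Finset.mem_filter, mem_hooks, hlen, Prod.mk.injEq, Prod.exists,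
      IsHook, IsQuotientHook]
    constructor
    · rintro ⟨hH, h1, h2, h3⟩
      have hw := nonneg_of_notMem_maya h2
      have hzw : 0 ≤ z - w := by
        by_contra hc
        have : (ℓ : ℤ) * (z - w) < ℓ * 0 := mul_lt_mul_of_pos_left (by omega) hℓ
        omega
      lift w to ℕ using hw
      lift z to ℕ using by omega
      rw [natCast_mem_maya] at h1 h2
      refine ⟨z, w, q, q', ⟨⟨by omega, h1, h2, ?_⟩, h3⟩, ⟨rfl, rfl⟩, rfl, rfl⟩
      rintro (rfl : z = w)
      rw [sub_self, mul_zero] at h3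
      omega
    · rintro ⟨a, b, i, j, ⟨⟨hba, ha, hb, hi⟩, h3⟩, ⟨rfl, rfl⟩, rfl, rfl⟩
      refine ⟨?_, natCast_mem_maya.2 ha, fun h => hb (natCast_mem_maya.1 h), h3⟩
      rcases hba.lt_or_eq with hlt | heq
      · left
        have : (ℓ : ℤ) * 0 < ℓ * (a - b) := mul_lt_mul_of_pos_left (by omega) hℓ
        omega
      · right
        subst heq
        rw [sub_self, mul_zero] at h3
        exact ⟨by omega, hi rfl⟩

end Split

/-! ### Comparison of symbol, quotient and core -/

open Classical in
theorem splitCount_eq_add {d ℓ : ℕ} [NeZero ℓ] (Z : Symbol (d * ℓ)) (q q' : Fin (d * ℓ)) {h : ℤ} (hh : h ≠ 0) :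
    splitCount Z q q' h = (if IsQuotientHook Z q q' h then splitCount Z q q' h else 0) +
      (if IsQuotientHook Z q' q (-h) then splitCount Z q' q (-h) else 0) +
        splitCount (core Z) q q' h := by
  have hℓ : (0 : ℤ) < ℓ := by exact_mod_cast NeZero.pos ℓ
  by_cases hH : IsQuotientHook Z q q' h
  · have hH' : ¬ IsQuotientHook Z q' q (-h) := by
      intro h2
      rcases hH with h1 | ⟨h1, h3⟩ <;> rcases h2 with h2 | ⟨h2, h4⟩
      · omega
      · omega
      · omega
      · exact lt_asymm h3 h4
    have h0 : splitCount (core Z) q q' h = 0 := by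
      refine pairCount_range_eq_zero hℓ ?_
      change charge Z q - charge Z q' ≤ h
      rcases hH with h1 | h1 <;> omega
    rw [if_pos hH, if_neg hH', h0, add_zero, add_zero]
  · have h1 : h ≤ charge Z q - charge Z q' := by
      by_contra h2
      exact hH (Or.inl (by omega))
    have hH' : IsQuotientHook Z q' q (-h) := by
      rcases h1.lt_or_eq with h2 | h2
      · exact Or.inl (by omega)
      · refine Or.inr ⟨by omega, ?_⟩
        rcases lt_trichotomy q q' with h3 | rfl | h3
        · exact h3
        -- With `q = q'` the charge difference is `0`, contradicting `h ≠ 0`.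
        · omega
        · exact absurd (Or.inr ⟨h2.symm, h3⟩) hH
    have h0 : splitCount (core Z) q' q (-h) = 0 := by
      refine pairCount_range_eq_zero hℓ ?_
      change charge Z q' - charge Z q ≤ -h
      omega
    have key : splitCount Z q q' h + splitCount (core Z) q' q (-h) =
        splitCount (core Z) q q' h + splitCount Z q' q (-h) :=
      pairCount_add_pairCount_core (Z q) (Z q') hℓ _ _ h
    rw [if_neg hH, if_pos hH']
    omega

/-! ### The twist and hook lengths -/

/-- The entry `a` stays in place while its component index is rotated by an amount depending only on
`a / ℓ`. -/
theorem mem_symbolTwist {d ℓ : ℕ} [NeZero d] [NeZero ℓ] (e : Fin d) (S : Symbol d) (a : ℕ)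
    (i : Fin d) : a ∈ symbolTwist ℓ e S (i + Fin.ofNat d (a / ℓ * e)) ↔ a ∈ S i := by
  have h : ((i + Fin.ofNat d (a / ℓ * e) : Fin d) : ℕ) + a * d =
      twistPerm d ℓ e ((i : ℕ) + a * d) := by
    have ha : a * d = a / ℓ * (d * ℓ) + a % ℓ * d := by
      conv_lhs => rw [← Nat.div_add_mod' a ℓ]
      ring
    change _ = twistFun d ℓ e _
    rw [ha, add_comm (i : ℕ), twistFun_eq d ℓ e _ _ _ (Nat.mod_lt _ (NeZero.pos ℓ)) i.2,
      Fin.val_add, Fin.val_ofNat, Nat.add_mod_mod]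
    ring
  change a ∈ component d ((assemble d S).map (twistPerm d ℓ e).toEmbedding) _ ↔ _
  rw [mem_component, h, ← mem_assemble]
  exact Finset.mem_map' _

open Classical in
theorem count_nonzeroPart_map {α : Type*} (F : Finset α) (f : α → ℝ) (h : ℝ) :
    (nonzeroPart (F.val.map f)).count h = if h ≠ 0 then (F.filter fun z => f z = h).card else 0 := by
  rw [nonzeroPart, Multiset.count_filter, Multiset.count_map]
  simp only [eq_comm (a := h)]
  rfl

/-- Component indices matter to a hook only when `a = b`, that is, for length zero; elsewhere the
rotation is a bijection of hooks. -/
theorem nonzeroPart_hookLengths_symbolTwist {d ℓ : ℕ} [NeZero d] [NeZero ℓ] (e : Fin d)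
    (S : Symbol d) : nonzeroPart (hookLengths (minimalData d) (symbolTwist ℓ e S)) =
      nonzeroPart (hookLengths (minimalData d) S) := by
  classical
  ext h
  rw [hookLengths, hookLengths, count_nonzeroPart_map, count_nonzeroPart_map]
  split_ifs with hh
  · symm
    refine Finset.card_bij (fun z _ => (z.1, z.2.1, z.2.2.1 + Fin.ofNat d (z.1 / ℓ * e),
      z.2.2.2 + Fin.ofNat d (z.2.1 / ℓ * e))) ?_ ?_ ?_
    · rintro ⟨a, b, i, j⟩ hz
      simp only [Finset.mem_filter, mem_hooks, IsHook, hookLength_minimalData,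
        mem_symbolTwist] at hz ⊢
      refine ⟨⟨hz.1.1, hz.1.2.1, hz.1.2.2.1, fun hab => absurd hz.2 ?_⟩, hz.2⟩
      rw [hab, sub_self]
      exact hh.symm
    · rintro ⟨a, b, i, j⟩ - ⟨a', b', i', j'⟩ - hz
      simp only [Prod.mk.injEq] at hz ⊢
      obtain ⟨rfl, rfl, h1, h2⟩ := hz
      exact ⟨rfl, rfl, add_right_cancel h1, add_right_cancel h2⟩
    · rintro ⟨a, b, i, j⟩ hz
      refine ⟨(a, b, i - Fin.ofNat d (a / ℓ * e), j - Fin.ofNat d (b / ℓ * e)), ?_, ?_⟩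
      · rw [← sub_add_cancel i (Fin.ofNat d (a / ℓ * e)),
          ← sub_add_cancel j (Fin.ofNat d (b / ℓ * e))] at hz
        simp only [Finset.mem_filter, mem_hooks, IsHook, hookLength_minimalData,
          mem_symbolTwist] at hz ⊢
        refine ⟨⟨hz.1.1, hz.1.2.1, hz.1.2.2.1, fun hab => absurd hz.2 ?_⟩, hz.2⟩
        rw [hab, sub_self]
        exact hh.symm
      · simp
  · rfl

theorem exists_nat_of_mem_hookLengths {d : ℕ} [NeZero d] {S : Symbol d} {h : ℝ}
    (hh : h ∈ hookLengths (minimalData d) S) : ∃ n : ℕ, h = n := by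
  obtain ⟨z, hz, rfl⟩ := Multiset.mem_map.1 hh
  have h1 := ((mem_hooks S z).1 hz).1
  exact ⟨z.1 - z.2.1, by rw [hookLength_minimalData, Nat.cast_sub h1]⟩

open Classical in
theorem nonzeroPart_hookLengths_eq {d ℓ : ℕ} [NeZero d] [NeZero ℓ] (S : Symbol d) :
    nonzeroPart (hookLengths (minimalData d) S) =
      nonzeroPart ((hookLengths (quotientData ℓ S) (balancedQuotientBy ℓ S)).map fun x => |x|) +
        nonzeroPart (hookLengths (minimalData d) (coreBy ℓ S)) := by
  have hmem : ∀ {M : Multiset ℝ} {h : ℝ}, h ∈ nonzeroPart M → h ∈ M ∧ h ≠ 0 :=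
    fun h => Multiset.mem_filter.1 h
  ext h
  by_cases hh : ∃ n : ℕ, 0 < n ∧ h = n
  · obtain ⟨n, hn, rfl⟩ := hh
    have hn0 : (n : ℝ) ≠ 0 := by exact_mod_cast hn.ne'
    have hnz : (n : ℤ) ≠ 0 := by exact_mod_cast hn.ne'
    have habs : ((hooks (balancedQuotientBy ℓ S)).filter
        fun z => |hookLength (quotientData ℓ S) z| = n).card =
        ((hooks (balancedQuotientBy ℓ S)).filter
          fun z => hookLength (quotientData ℓ S) z = (n : ℤ)).card +
        ((hooks (balancedQuotientBy ℓ S)).filter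
          fun z => hookLength (quotientData ℓ S) z = (-n : ℤ)).card := by
      rw [← Finset.card_union_of_disjoint, ← Finset.filter_or]
      · refine congrArg Finset.card (Finset.filter_congr fun z _ => ?_)
        rw [abs_eq (Nat.cast_nonneg n)]
        push_cast
        rfl
      · refine Finset.disjoint_filter.2 fun z _ h1 h2 => hnz ?_
        have := h1.symm.trans h2
        norm_cast at this
        omega
    rw [Multiset.count_add, hookLengths, hookLengths, hookLengths, Multiset.map_map,
      count_nonzeroPart_map, count_nonzeroPart_map, count_nonzeroPart_map, if_pos hn0, if_pos hn0,
      if_pos hn0, card_hooks_eq_sum_splitCount (ℓ := ℓ) S hn,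
      card_hooks_eq_sum_splitCount (ℓ := ℓ) (coreBy ℓ S) hn, splitSymbol_coreBy]
    simp only [Function.comp_apply]
    rw [habs, card_hooks_balancedQuotientBy, card_hooks_balancedQuotientBy,
      -- Swapping `q` and `q'` in the sum for length `-n` aligns it with the opposite pairs in
      -- `splitCount_eq_add`.
      Finset.sum_comm (f := fun q q' => if IsQuotientHook (splitSymbol ℓ S) q q' (-n) then
        splitCount (splitSymbol ℓ S) q q' (-n) else 0)]
    simp only [← Finset.sum_add_distrib]
    exact Finset.sum_congr rfl fun q _ => Finset.sum_congr rfl fun q' _ =>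
      splitCount_eq_add (splitSymbol ℓ S) q q' hnz
  -- All lengths are integers, so away from positive integers every multiplicity vanishes.
  · have hS : ∀ T : Symbol d, h ∉ nonzeroPart (hookLengths (minimalData d) T) := by
      intro T hT
      obtain ⟨n, rfl⟩ := exists_nat_of_mem_hookLengths (hmem hT).1
      exact hh ⟨n, Nat.pos_of_ne_zero (by exact_mod_cast (hmem hT).2), rfl⟩
    rw [Multiset.count_add, Multiset.count_eq_zero_of_notMem (hS _),
      Multiset.count_eq_zero_of_notMem (hS _), Multiset.count_eq_zero_of_notMem]
    intro hQ
    obtain ⟨h1, h2⟩ := hmem hQ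
    obtain ⟨x, hx, rfl⟩ := Multiset.mem_map.1 h1
    obtain ⟨z, -, rfl⟩ := Multiset.mem_map.1 hx
    rw [hookLength_quotientData] at h2 hh
    rw [abs_ne_zero, Int.cast_ne_zero] at h2
    exact hh ⟨_, Int.natAbs_pos.2 h2, by rw [Nat.cast_natAbs, Int.cast_abs]⟩

end DSymb

theorem theorem5p4 (d ℓ : ℕ) [NeZero d] [NeZero ℓ] (e : Fin d) (S : DSymb.Symbol d) :
    DSymb.nonzeroPart (DSymb.hookLengths (DSymb.minimalData d) S) =
      DSymb.nonzeroPart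
          ((DSymb.hookLengths (DSymb.quotientData ℓ (DSymb.symbolTwist ℓ e S))
            (DSymb.twistedQuotient ℓ e S)).map fun x => |x|) +
        DSymb.nonzeroPart
          (DSymb.hookLengths (DSymb.minimalData d) (DSymb.twistedCore ℓ e S)) := by
  rw [← DSymb.nonzeroPart_hookLengths_symbolTwist (ℓ := ℓ) e S,
    ← DSymb.nonzeroPart_hookLengths_symbolTwist (ℓ := ℓ) e (DSymb.twistedCore ℓ e S),
    DSymb.twistedCore, Equiv.apply_symm_apply]
  exact DSymb.nonzeroPart_hookLengths_eq (DSymb.symbolTwist ℓ e S)
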